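/- Let $T$ be a first-order theory in a language $L$, let $D$ be a set of complete types of $T$ over the empty set in finitely many variables (a diagram), and let $\mathfrak C$ be a model of $T$. *Types.* A set $A\subseteq\mathfrak C$ is a $D$-set if $\operatorname{tp}(\bar a,\emptyset)\in D$ for every finite tuple $\bar a$ from $A$. For $A\subseteq \mathfrak C$, $S_D(A)$ is the set of complete types $p$ over $A$ in one variable (with respect to the theory of $\mathfrak C$ with names for the elements of $A$) such that $A\cup\{c\}$ is a $D$-set whenever $c$, in some elementary extension of $\mathfrak C$, realizes $p$. *Homogeneity.* For a cardinal $\lambda$, an elementary submodel $M\preceq\mathfrak C$ is $(D,\lambda)$-homogeneous if $M$ is a $D$-set and $M$ realizes every $p\in S_D(A)$ for every $A\subseteq M$ with $|A|<\lambda$. *Rank.* Let $A\subseteq\mathfrak C$. For a set of formulas $p(\bar x)$ with finitely many parameters, all in $A$, define $R_A[p]\ge\alpha$ by induction on the ordinal $\alpha$: $R_A[p]\ge 0$ if $p$ is realized in $\mathfrak C$; for $\delta$ a limit, $R_A[p]\ge\delta$ if $R_A[p]\ge\beta$ for all $\beta<\delta$; and $R_A[p]\ge\alpha+1$ if (a)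 there is a formula $\phi(\bar x,\bar a)$ with $\bar a\in A$ such that $R_A[p\cup\{\phi(\bar x,\bar a)\}]\ge\alpha$ and $R_A[p\cup\{\neg\phi(\bar x,\bar a)\}]\ge\alpha$, and (b) for every finite tuple $\bar a\in A$ there is $q(\bar x,\bar y)\in D$ such that $R_A[p\cup q(\bar x,\bar a)]\ge\alpha$. For an arbitrary set of formulas $p$ over $A$, $R_A[p]$ is the minimum of $R_A[q]$ over all $q\subseteq p\restriction B$ with $B\subseteq\operatorname{dom}(p)$ finite. Say that $D$ is totally transcendental if $R_A[p]<\infty$ (that is, $R_A[p]\not\ge\alpha$ for some ordinal $\alpha$) for every $A\subseteq\mathfrak C$ and every set $p$ of formulas over $A$ in finitely many variables. **Theorem 4.9.** Suppose that $\mathfrak C$ is $(D,\chi)$-homogeneous and that $D$ is totally transcendental. Let $\mu$ be an infinite cardinal with $\mu<\chi$, let $\alpha>0$ be an ordinal, and let $\langle M_i : i<\alpha\rangle$ be an increasing chain (not necessarily strictly increasing) of $(D,\mu)$-homogeneous elementary submodels of $\mathfrak C$. Then $\bigcup_{i<\alpha}M_i$ is an elementary submodel of $\mathfrak C$ and is $(D,\mu)$-homogeneous.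 -/

import Mathlib

universe u v w x

namespace FiniteDiagram

open FirstOrder FirstOrder.Language Cardinal

/-- A diagram `D ⊆ D(T)`: a set of complete types of `T` over the empty set, sorted by their
number of variables. -/
abbrev Diagram {L : FirstOrder.Language.{u, v}} (T : L.Theory) : Type (max u v) :=
  ∀ n : ℕ, Set (T.CompleteType (Fin n))

section Parameters

variable {L : FirstOrder.Language.{u, v}} {C : Type w} {n : ℕ}

/-! A formula in the variables `x₀, …, xₙ₋₁` with parameters in `C` is an `L`-formula whose free
variables are the elements of `C ⊕ Fin n`; `Sum.inl c` stands for the parameter `c`, and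
`Sum.inr i` for the variable `xᵢ`. -/

open Classical in
/-- The set of parameters occurring in a formula. -/
def params (φ : L.Formula (C ⊕ Fin n)) : Set C :=
  {c | Sum.inl c ∈ φ.freeVarFinset}

/-- `dom p`: the set of parameters occurring in the formulas of `p`. -/
def dom (p : Set (L.Formula (C ⊕ Fin n))) : Set C :=
  {c | ∃ φ ∈ p, c ∈ params φ}

/-- `p ↾ B`: the formulas of `p` all of whose parameters are in `B`. -/
def restrict (p : Set (L.Formula (C ⊕ Fin n))) (B : Set C) : Set (L.Formula (C ⊕ Fin n)) :=
  {φ | φ ∈ p ∧ params φ ⊆ B}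

/-- The tuple `c` of elements of `C` realizes the set `p` of formulas with parameters in `C`. -/
def Realizes [L.Structure C] (c : Fin n → C) (p : Set (L.Formula (C ⊕ Fin n))) : Prop :=
  ∀ φ ∈ p, φ.Realize (Sum.elim id c)

/-- `p` is a complete type over `A` in `n` variables (in the sense of the structure `C`): its
parameters are in `A`, it is finitely satisfiable in `C`, and it decides every formula over `A`.
By compactness these are the sets `tp(c, A)` for `n`-tuples `c` in elementary extensions
of `C`. -/
structure IsCompleteType [L.Structure C] (A : Set C) (p : Set (L.Formula (C ⊕ Fin n))) :
    Prop where
  dom_subset : dom p ⊆ A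
  finitely_satisfiable : ∀ s ⊆ p, s.Finite → ∃ c : Fin n → C, Realizes c s
  complete : ∀ φ : L.Formula (C ⊕ Fin n), params φ ⊆ A → φ ∈ p ∨ φ.not ∈ p

/-- `q(x, a)`, for a complete type `q(x, y)` over the empty set in `n + m` variables and a tuple
`a` of length `m`. -/
def substitute {T : L.Theory} {m : ℕ} (q : T.CompleteType (Fin (n + m))) (a : Fin m → C) :
    Set (L.Formula (C ⊕ Fin n)) :=
  {φ | ∃ ψ : L.Formula (Fin (n + m)), Formula.equivSentence ψ ∈ q ∧
    φ = ψ.relabel (Fin.addCases (fun i => Sum.inr i) (fun j => Sum.inl (a j)))}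

end Parameters

section Diagrams

variable {L : FirstOrder.Language.{u, v}} {T : L.Theory} (D : Diagram T)
  {C : Type w} [L.Structure C] [Nonempty C] [C ⊨ T]

/-- `A` is a `D`-set: the type over the empty set of every finite tuple from `A` is in `D`. -/
def IsDSet (A : Set C) : Prop :=
  ∀ (k : ℕ) (a : Fin k → C), (∀ i, a i ∈ A) → T.typeOf a ∈ D k

/-- `p ∈ S_D(A)` (in `n` variables): `p` is a complete type over `A`, and if `c` realizes `p` in
some elementary extension then `A ∪ c` is a `D`-set. For a finite tuple `e` from `A ∪ c`, given
here as a tuple of parameters in `A` and of variables, the formulas satisfied by `e` are the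
`ψ` with `ψ(e) ∈ p`. -/
structure IsDType (A : Set C) {n : ℕ} (p : Set (L.Formula (C ⊕ Fin n))) : Prop where
  isCompleteType : IsCompleteType A p
  mem_diagram : ∀ (k : ℕ) (e : Fin k → C ⊕ Fin n), (∀ i c, e i = Sum.inl c → c ∈ A) →
    ∃ q ∈ D k, ∀ ψ : L.Formula (Fin k), Formula.equivSentence ψ ∈ q ↔ ψ.relabel e ∈ p

/-- The elementary submodel `M` of `C` is a `(D, κ)`-homogeneous model: it is a `D`-model, and it
realizes every (one-variable) `p ∈ S_D(A)` for every `A ⊆ M` of cardinality less than `κ`. -/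
structure IsHomogeneous (κ : Cardinal.{w}) (M : L.ElementarySubstructure C) : Prop where
  isDSet : IsDSet D (M : Set C)
  realizes : ∀ A : Set C, A ⊆ (M : Set C) → #A < κ →
    ∀ p : Set (L.Formula (C ⊕ Fin 1)), IsDType D A p →
      ∃ c : Fin 1 → C, (∀ i, c i ∈ M) ∧ Realizes c p

/-- `R_A[p] ≥ α`, for a set `p` of formulas over a finite subset of `A`, by recursion on `α`. -/
noncomputable def FinRankGE (A : Set C) {n : ℕ} (α : Ordinal.{max u v w}) :
    Set (L.Formula (C ⊕ Fin n)) → Prop :=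
  Ordinal.limitRecOn (motive := fun _ => Set (L.Formula (C ⊕ Fin n)) → Prop) α
    (fun p => ∃ c : Fin n → C, Realizes c p)
    (fun _ ge p =>
      (∃ φ : L.Formula (C ⊕ Fin n), params φ ⊆ A ∧ ge (p ∪ {φ}) ∧ ge (p ∪ {φ.not})) ∧
      (∀ (m : ℕ) (a : Fin m → C), (∀ j, a j ∈ A) →
        ∃ q ∈ D (n + m), ge (p ∪ substitute q a)))
    (fun δ _ ge p => ∀ (β : Ordinal.{max u v w}) (hβ : β < δ), ge β hβ p)

/-- `R_A[p] ≥ α`, for an arbitrary set `p` of formulas over `A`; here `R_A[p]` is the minimum of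
`R_A[q]` over all `q ⊆ p ↾ B` with `B ⊆ dom p` finite. -/
def RankGE (A : Set C) {n : ℕ} (α : Ordinal.{max u v w})
    (p : Set (L.Formula (C ⊕ Fin n))) : Prop :=
  ∀ B : Set C, B ⊆ dom p → B.Finite → ∀ q : Set (L.Formula (C ⊕ Fin n)), q ⊆ restrict p B →
    FinRankGE D A α q

variable (C) in
/-- `D` is totally transcendental (with respect to the structure `C` in which the rank is
computed): `R_A[p] < ∞` for all `A ⊆ C` and all `p` over `A`. -/
def IsTotallyTranscendental : Prop :=
  ∀ (A : Set C) (n : ℕ) (p : Set (L.Formula (C ⊕ Fin n))), dom p ⊆ A →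
    ∃ α : Ordinal.{max u v w}, ¬ RankGE D A α p

end Diagrams

end FiniteDiagram

/-! The difficulty is that a set `A` of size less than `μ` in the union `N` need not lie in any
single `M i`. Finite non-splitting and symmetry move the problem into one member of the chain.

Let `c` realize in `C` a given type over `A`. Total transcendence makes the type of `c` over `N`
non-splitting over a finite set `B₀` (`exists_nonSplitting`: choose a finite restriction of least
rank). Being finite, `B₀` lies in some `M i`. Likewise the type over `M i` of each finite tuple `b`
from `A` does not split over some finite subset of `M i`. The union `E` of all these finite sets is
contained in `M i` and has size less than `μ`, so homogeneity of `M i` gives `a` in `M i` with the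
type of `c` over `E`. Symmetry (`NonSplitting.symmetry`) now says that `a` and `c` have the same
type over every such `b`, hence over `A`.

Symmetry holds because a formula true of `(a, b)` and false of `(c, b)` would order a sequence of
copies of `(c, b)` chosen inside `M i`. Non-splitting makes the sequence indiscernible, so it
stretches to order type `ℚ`. There every cut can be split again by the ordering formula, which makes
the rank unbounded (`IsTotallyTranscendental.false_of_order`).

Automorphisms are replaced throughout by partial elementary maps, and homogeneity by the extension
property `ExtendsMaps`. The case `ℵ₀` of this property passes to unions of chains, so rank arguments
are available over `N` before its homogeneity is known. -/

namespace FiniteDiagram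

open FirstOrder FirstOrder.Language Cardinal

/-! ### Parameters of relabelled formulas -/

section FreeVariables

variable {L : FirstOrder.Language.{u, v}} {α β : Type*}

theorem varFinsetLeft_relabel {γ δ : Type*} [DecidableEq α] [DecidableEq β] (g : α → β) (e : γ → δ)
    (t : L.Term (α ⊕ γ)) :
    (t.relabel (Sum.map g e)).varFinsetLeft = t.varFinsetLeft.image g := by
  induction t with
  | var i => rcases i with i | i <;> simp [Term.relabel, Term.varFinsetLeft]
  | func f ts ih => simp [Term.relabel, Term.varFinsetLeft, ih, Finset.biUnion_image]

theorem freeVarFinset_relabel [DecidableEq α] [DecidableEq β] (g : α → β) {k : ℕ}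
    (φ : L.BoundedFormula α k) :
    (φ.relabel (n := 0) (Sum.inl ∘ g)).freeVarFinset = φ.freeVarFinset.image g := by
  have key : ∀ {k : ℕ} (t : L.Term (α ⊕ Fin k)),
      (t.relabel (BoundedFormula.relabelAux (n := 0) (Sum.inl ∘ g) k)).varFinsetLeft
        = t.varFinsetLeft.image g := fun {k} t => by
    have : BoundedFormula.relabelAux (n := 0) (Sum.inl ∘ g : α → β ⊕ Fin 0) k
        = Sum.map g (Fin.natAdd 0) := by
      ext x; cases x <;> simp [BoundedFormula.relabelAux]
    rw [this, varFinsetLeft_relabel]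
  induction φ with
  | falsum => rfl
  | equal t₁ t₂ =>
    simp only [BoundedFormula.relabel, BoundedFormula.mapTermRel, BoundedFormula.freeVarFinset,
      key, Finset.image_union]
  | rel R ts =>
    simp only [BoundedFormula.relabel, BoundedFormula.mapTermRel, BoundedFormula.freeVarFinset,
      key, Finset.biUnion_image]
  | imp φ ψ h₁ h₂ =>
    simp only [BoundedFormula.relabel_imp, BoundedFormula.freeVarFinset, h₁, h₂,
      Finset.image_union]
  | all φ ih =>
    simp only [BoundedFormula.relabel_all, BoundedFormula.freeVarFinset, ih]

open Classical in
theorem mem_params_relabel {C I : Type*} {n : ℕ} (φ : L.Formula I) (e : I → C ⊕ Fin n) (c : C)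
    (h : c ∈ params (φ.relabel e)) : ∃ i ∈ φ.freeVarFinset, e i = Sum.inl c := by
  have h' := (Finset.ext_iff.1 (freeVarFinset_relabel e φ) (Sum.inl c)).1 (by
    simp only [params, Set.mem_ofPred_eq] at h
    convert h
    rfl)
  simpa only [Finset.mem_image] using h'

theorem params_relabel_map {C : Type*} {n : ℕ} (φ : L.Formula (C ⊕ Fin n)) (d : C → C) :
    params (φ.relabel (Sum.map d id)) ⊆ d '' params φ := by
  intro c hc
  obtain ⟨i | i, hi, hc⟩ := mem_params_relabel _ _ _ hc
  · refine ⟨i, ?_, Sum.inl_injective hc⟩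
    simp only [params, Set.mem_ofPred_eq]
    convert hi
  · simp at hc

theorem params_not {C : Type*} {n : ℕ} (φ : L.Formula (C ⊕ Fin n)) :
    params φ.not = params φ := by
  ext c
  simp [params, BoundedFormula.freeVarFinset]

theorem params_finite {C : Type*} {n : ℕ} (φ : L.Formula (C ⊕ Fin n)) : (params φ).Finite := by
  classical
  exact (φ.freeVarFinset.finite_toSet).preimage Sum.inl_injective.injOn

/-- A formula with parameters in `A` is a formula in variables indexed by `A`. -/
theorem exists_formula_subtype {C : Type w} [L.Structure C] {n : ℕ} {A : Set C}
    (φ : L.Formula (C ⊕ Fin n)) (h : params φ ⊆ A) :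
    ∃ ψ : L.Formula (A ⊕ Fin n), ∀ (v : C → C) (c : Fin n → C),
      ψ.Realize (Sum.elim (fun a => v a) c) ↔ φ.Realize (Sum.elim v c) := by
  classical
  refine ⟨φ.restrictFreeVar fun i => match i with
    | ⟨Sum.inl c, hc⟩ => Sum.inl ⟨c, h (by simpa [params] using hc)⟩
    | ⟨Sum.inr j, _⟩ => Sum.inr j, fun v c => ?_⟩
  refine BoundedFormula.realize_restrictFreeVar _ ?_
  rintro ⟨i | j, hi⟩ <;> rfl

end FreeVariables

/-! ### Calculus of partial elementary maps -/

section PartialElementary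

variable (L : FirstOrder.Language.{u, v}) {C : Type w} [L.Structure C]

/-- A binary relation on `C`, seen as a partial map, is elementary: it preserves the truth of
formulas. -/
def IsPartialElementary (R : Set (C × C)) : Prop :=
  ∀ φ : L.Formula R, φ.Realize (fun r => r.1.1) ↔ φ.Realize (fun r => r.1.2)

/-- The diagonal of `B`, seen as a partial map. -/
def diag (B : Set C) : Set (C × C) := (fun b => (b, b)) '' B

/-- The set of pairs of corresponding coordinates of two tuples. -/
def pairs {I : Type*} (f g : I → C) : Set (C × C) := Set.range fun i => (f i, g i)

variable {L} {R S : Set (C × C)}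

theorem IsPartialElementary.realize_iff (h : IsPartialElementary L R) {I : Type*} {f g : I → C}
    (hfg : ∀ i, (f i, g i) ∈ R) (φ : L.Formula I) : φ.Realize f ↔ φ.Realize g := by
  have := h (φ.relabel fun i => (⟨_, hfg i⟩ : R))
  simpa [Formula.realize_relabel, Function.comp_def] using this

theorem IsPartialElementary.of_realize_iff {I : Type*} (f g : I → C)
    (h : ∀ φ : L.Formula I, φ.Realize f ↔ φ.Realize g)
    (hR : ∀ r ∈ R, ∃ i, f i = r.1 ∧ g i = r.2) : IsPartialElementary L R := by
  intro φ
  choose e he he' using hR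
  have := h (φ.relabel fun r : R => e r r.2)
  rw [Formula.realize_relabel, Formula.realize_relabel] at this
  convert this using 2
  · ext r; exact (he r r.2).symm
  · ext r; exact (he' r r.2).symm

theorem IsPartialElementary.of_imp {I : Type*} (f g : I → C)
    (h : ∀ φ : L.Formula I, φ.Realize f → φ.Realize g)
    (hR : ∀ r ∈ R, ∃ i, f i = r.1 ∧ g i = r.2) : IsPartialElementary L R := by
  refine .of_realize_iff f g (fun φ => ⟨h φ, fun hg => ?_⟩) hR
  by_contra hf
  exact Formula.realize_not.1 (h φ.not (Formula.realize_not.2 hf)) hg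

theorem IsPartialElementary.mono (h : IsPartialElementary L S) (hRS : R ⊆ S) :
    IsPartialElementary L R :=
  .of_realize_iff (fun r : S => r.1.1) (fun r : S => r.1.2) h fun r hr => ⟨⟨r, hRS hr⟩, rfl, rfl⟩

theorem IsPartialElementary.swap (h : IsPartialElementary L R) :
    IsPartialElementary L (Prod.swap '' R) :=
  .of_realize_iff (fun r : R => r.1.2) (fun r : R => r.1.1) (fun φ => (h φ).symm) (by
    rintro _ ⟨r, hr, rfl⟩
    exact ⟨⟨r, hr⟩, rfl, rfl⟩)

theorem IsPartialElementary.comp (hR : IsPartialElementary L R) (hS : IsPartialElementary L S)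
    {U : Set (C × C)} (hU : ∀ r ∈ U, ∃ y, (r.1, y) ∈ R ∧ (y, r.2) ∈ S) :
    IsPartialElementary L U := by
  choose y hy hy' using hU
  intro φ
  exact (hR.realize_iff (f := fun r : U => r.1.1) (g := fun r : U => y r r.2)
    (fun r => hy r r.2) φ).trans (hS.realize_iff (g := fun r : U => r.1.2) (fun r => hy' r r.2) φ)

theorem isPartialElementary_diag (B : Set C) : IsPartialElementary L (diag B) :=
  .of_realize_iff (fun b : B => b.1) (fun b : B => b.1) (fun _ => Iff.rfl) (by
    rintro _ ⟨b, hb, rfl⟩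
    exact ⟨⟨b, hb⟩, rfl, rfl⟩)

/-- Equality is a formula, so an elementary relation is automatically one-to-one. -/
theorem IsPartialElementary.injective (h : IsPartialElementary L R) {a b c : C}
    (hac : (a, c) ∈ R) (hbc : (b, c) ∈ R) : a = b := by
  have := (h.realize_iff (f := ![a, b]) (g := ![c, c])
    (by intro i; fin_cases i <;> simpa) (Term.equal (Term.var 0) (Term.var 1))).2
    (by simp [Formula.realize_equal])
  simpa [Formula.realize_equal] using this

/-- Realization of formulas with parameters is preserved by a partial elementary map defined at the
parameters and at the values of the variables. -/
theorem IsPartialElementary.realize_params (h : IsPartialElementary L R) {n : ℕ}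
    (φ : L.Formula (C ⊕ Fin n)) {v v' : C → C} {c c' : Fin n → C}
    (hv : ∀ a ∈ params φ, (v a, v' a) ∈ R) (hc : ∀ i, (c i, c' i) ∈ R) :
    φ.Realize (Sum.elim v c) ↔ φ.Realize (Sum.elim v' c') := by
  obtain ⟨ψ, hψ⟩ := exists_formula_subtype φ subset_rfl
  rw [← hψ, ← hψ]
  refine h.realize_iff ?_ ψ
  rintro (a | i)
  · exact hv a a.2
  · exact hc i

end PartialElementary

/-! ### Homogeneity as extension of partial elementary maps -/

section Extension

variable (L : FirstOrder.Language.{u, v}) {C : Type w} [L.Structure C]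

/-- Partial elementary maps with fewer than `κ` values, all in `X`, can be extended to any further
point with a value in `X`. -/
def ExtendsMaps (κ : Cardinal.{w}) (X : Set C) : Prop :=
  ∀ R : Set (C × C), IsPartialElementary L R → (∀ r ∈ R, r.2 ∈ X) → #(Prod.snd '' R) < κ →
    ∀ c : C, ∃ d ∈ X, IsPartialElementary L (insert (c, d) R)

variable {L}

theorem ExtendsMaps.mono {κ κ' : Cardinal.{w}} {X : Set C} (h : ExtendsMaps L κ X)
    (hκ : κ' ≤ κ) : ExtendsMaps L κ' X :=
  fun R hR hX hc => h R hR hX (hc.trans_le hκ)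

/-- Push the type of `c` over the domain of `R` forward along `R`. The result is a `D`-type because
all of `C` is a `D`-set, and a realization of it in `M` is the required value. -/
theorem IsHomogeneous.extendsMaps {T : L.Theory} {D : Diagram T} [Nonempty C] [C ⊨ T]
    (hC : IsDSet D (Set.univ : Set C)) {κ : Cardinal.{w}} {M : L.ElementarySubstructure C}
    (hM : IsHomogeneous D κ M) : ExtendsMaps L κ (M : Set C) := by
  intro R hR hX hcard c
  set A : Set C := Prod.snd '' R with hA
  have hex : ∀ y : C, ∃ x, y ∈ A → (x, y) ∈ R := by
    intro y
    by_cases hy : y ∈ A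
    · obtain ⟨⟨x, y'⟩, hr, rfl⟩ := hy
      exact ⟨x, fun _ => hr⟩
    · exact ⟨y, fun h => absurd h hy⟩
  choose h hh using hex
  let p : Set (L.Formula (C ⊕ Fin 1)) :=
    {φ | params φ ⊆ A ∧ φ.Realize (Sum.elim h fun _ => c)}
  have hp : IsDType D A p := by
    refine ⟨⟨?_, ?_, ?_⟩, ?_⟩
    · rintro a ⟨φ, hφ, ha⟩
      exact hφ.1 ha
    · intro s hs hfin
      have : Finite s := hfin
      have hψ := fun φ : s => exists_formula_subtype φ.1 (hs φ.2).1
      choose ψ hψ using hψ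
      -- Joint satisfiability of finitely many formulas over `A` is a single existential formula. It
      -- holds at the `R`-preimages with witness `c`, so `R` carries it to `A`.
      have key := (hR.realize_iff (f := fun a : A => h a) (g := fun a : A => (a : C))
        (fun a => hh a a.2) ((Formula.iInf ψ).iExs (Fin 1))).1 (by
          rw [Formula.realize_iExs]
          refine ⟨fun _ => c, ?_⟩
          rw [Formula.realize_iInf]
          intro φ
          rw [hψ]
          exact (hs φ.2).2)
      rw [Formula.realize_iExs] at key
      obtain ⟨d, hd⟩ := key
      rw [Formula.realize_iInf] at hd
      exact ⟨d, fun φ hφ => (hψ ⟨φ, hφ⟩ id d).1 (hd ⟨φ, hφ⟩)⟩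
    · intro φ hφ
      by_cases hr : φ.Realize (Sum.elim h fun _ => c)
      · exact Or.inl ⟨hφ, hr⟩
      · exact Or.inr ⟨by rwa [params_not], Formula.realize_not.2 hr⟩
    · intro k e he
      refine ⟨T.typeOf (Sum.elim h (fun _ => c) ∘ e), hC _ _ fun _ => Set.mem_univ _,
        fun ψ => ?_⟩
      rw [Theory.CompleteType.formula_mem_typeOf]
      refine ⟨fun hr => ⟨fun a ha => ?_, Formula.realize_relabel.2 hr⟩,
        fun hr => Formula.realize_relabel.1 hr.2⟩
      obtain ⟨i, -, hi⟩ := mem_params_relabel ψ e a ha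
      exact he i a hi
  obtain ⟨d, hdM, hd⟩ := hM.realizes A (by rintro _ ⟨r, hr, rfl⟩; exact hX r hr) hcard p hp
  refine ⟨d 0, hdM 0, ?_⟩
  refine .of_imp (I := A ⊕ Fin 1) (Sum.elim (fun a => h a) fun _ => c)
    (Sum.elim (fun a => a) d) (fun ψ hψ => ?_) ?_
  · have := hd (ψ.relabel (Sum.map (↑) id)) ⟨?_, ?_⟩
    · rw [Formula.realize_relabel] at this
      convert this using 1
      ext (a | a) <;> rfl
    · intro a ha
      obtain ⟨i | i, -, hi⟩ := mem_params_relabel _ _ _ ha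
      · simp only [Sum.map_inl, Sum.inl.injEq] at hi
        exact hi ▸ i.2
      · simp at hi
    · rw [Formula.realize_relabel]
      convert hψ using 1
      ext (a | a) <;> rfl
  · rintro r (rfl | hr)
    · exact ⟨Sum.inr 0, rfl, rfl⟩
    · have hrA : r.2 ∈ A := ⟨r, hr, rfl⟩
      exact ⟨Sum.inl ⟨r.2, hrA⟩, hR.injective (hh _ hrA) hr, rfl⟩

theorem mk_image_snd_lt_aleph0 {R : Set (C × C)} (hR : R.Finite) : #(Prod.snd '' R) < ℵ₀ :=
  (hR.image _).lt_aleph0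

theorem pairs_finite {I : Type*} [Finite I] (f g : I → C) : (pairs f g).Finite :=
  Set.finite_range _

theorem swap_pairs {I : Type*} (f g : I → C) : Prod.swap '' pairs f g = pairs g f := by
  rw [pairs, ← Set.range_comp]; rfl

theorem ExtendsMaps.exists_map {X : Set C} (h : ExtendsMaps L ℵ₀ X) {R : Set (C × C)}
    (hR : IsPartialElementary L R) (hX : ∀ r ∈ R, r.2 ∈ X) (hfin : R.Finite) {S : Set C}
    (hS : S.Finite) :
    ∃ d : C → C, (∀ s ∈ S, d s ∈ X) ∧
      IsPartialElementary L (R ∪ (fun s => (s, d s)) '' S) := by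
  classical
  induction S, hS using Set.Finite.induction_on with
  | empty => exact ⟨id, by simp, by simpa using hR⟩
  | @insert a S ha hS ih =>
    obtain ⟨d, hd, hdR⟩ := ih
    obtain ⟨b, hb, hbR⟩ := h _ hdR (by
      rintro _ (hr | ⟨s, hs, rfl⟩)
      exacts [hX _ hr, hd s hs]) (mk_image_snd_lt_aleph0 (hfin.union (hS.image _))) a
    have hne : ∀ s ∈ S, Function.update d a b s = d s := fun s hs =>
      Function.update_of_ne (fun h => ha (by rwa [← h])) _ _
    refine ⟨Function.update d a b, ?_, hbR.mono ?_⟩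
    · rintro s (rfl | hs)
      · simpa using hb
      · rw [hne s hs]; exact hd s hs
    · rintro _ (hr | ⟨s, rfl | hs, rfl⟩)
      · exact Or.inr (Or.inl hr)
      · simp
      · simp only [hne s hs]
        exact Or.inr (Or.inr ⟨s, hs, rfl⟩)

theorem ExtendsMaps.exists_tuple {X : Set C} (h : ExtendsMaps L ℵ₀ X) {R : Set (C × C)}
    (hR : IsPartialElementary L R) (hX : ∀ r ∈ R, r.2 ∈ X) (hfin : R.Finite) {I : Type*} [Finite I]
    (c : I → C) :
    ∃ d : I → C, (∀ i, d i ∈ X) ∧ IsPartialElementary L (R ∪ pairs c d) := by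
  obtain ⟨d, hd, hdR⟩ := h.exists_map hR hX hfin (Set.finite_range c)
  refine ⟨fun i => d (c i), fun i => hd _ ⟨i, rfl⟩, hdR.mono ?_⟩
  rintro _ (hr | ⟨i, rfl⟩)
  · exact Or.inl hr
  · exact Or.inr ⟨c i, ⟨i, rfl⟩, rfl⟩

end Extension

/-! ### Monotonicity and invariance of the rank -/

section Rank

variable {L : FirstOrder.Language.{u, v}} {T : L.Theory} {D : Diagram T}
  {C : Type w} [L.Structure C] {A : Set C} {n : ℕ}
  {p p' : Set (L.Formula (C ⊕ Fin n))} {α : Ordinal.{max u v w}}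

theorem finRankGE_zero : FinRankGE D A 0 p ↔ ∃ c : Fin n → C, Realizes c p := by
  rw [FinRankGE, Ordinal.limitRecOn_zero]

theorem finRankGE_add_one : FinRankGE D A (α + 1) p ↔
    (∃ φ : L.Formula (C ⊕ Fin n), params φ ⊆ A ∧ FinRankGE D A α (p ∪ {φ}) ∧
      FinRankGE D A α (p ∪ {φ.not})) ∧
    ∀ (m : ℕ) (a : Fin m → C), (∀ j, a j ∈ A) →
      ∃ q ∈ D (n + m), FinRankGE D A α (p ∪ substitute q a) := by
  rw [FinRankGE, Ordinal.limitRecOn_add_one]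
  rfl

theorem finRankGE_of_isSuccLimit (hα : Order.IsSuccLimit α) :
    FinRankGE D A α p ↔ ∀ β < α, FinRankGE D A β p := by
  rw [FinRankGE, Ordinal.limitRecOn_limit _ _ _ _ hα]
  rfl

theorem FinRankGE.anti (h : FinRankGE D A α p) (hp : p' ⊆ p) : FinRankGE D A α p' := by
  induction α using Ordinal.limitRecOn generalizing p p' with
  | zero =>
    rw [finRankGE_zero] at h ⊢
    obtain ⟨c, hc⟩ := h
    exact ⟨c, fun φ hφ => hc φ (hp hφ)⟩
  | add_one α ih =>
    rw [finRankGE_add_one] at h ⊢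
    obtain ⟨⟨φ, hφ, h₁, h₂⟩, h₃⟩ := h
    refine ⟨⟨φ, hφ, ih h₁ (Set.union_subset_union_left _ hp),
      ih h₂ (Set.union_subset_union_left _ hp)⟩, fun m a ha => ?_⟩
    obtain ⟨q, hq, h₄⟩ := h₃ m a ha
    exact ⟨q, hq, ih h₄ (Set.union_subset_union_left _ hp)⟩
  | limit α hα ih =>
    rw [finRankGE_of_isSuccLimit hα] at h ⊢
    exact fun β hβ => ih β hβ (h β hβ) hp

/-- `RankGE` only tests subsets of `p`, so by monotonicity it follows from `FinRankGE` of `p`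
itself. Later arguments can therefore use the recursion alone. -/
theorem IsTotallyTranscendental.exists_not_finRankGE (hD : IsTotallyTranscendental D C)
    (hpA : dom p ⊆ A) : ∃ α : Ordinal.{max u v w}, ¬ FinRankGE D A α p := by
  obtain ⟨α, hα⟩ := hD A n p hpA
  refine ⟨α, fun h => hα fun B hB hfin q hq => h.anti fun φ hφ => (hq hφ).1⟩

/-- The formulas `φ` and `φ'` correspond to each other under the partial map `R`. -/
def Corresponds (R : Set (C × C)) (φ φ' : L.Formula (C ⊕ Fin n)) : Prop :=
  ∀ c d : Fin n → C, IsPartialElementary L (R ∪ pairs c d) →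
    (φ.Realize (Sum.elim id c) ↔ φ'.Realize (Sum.elim id d))

theorem Corresponds.mono {R S : Set (C × C)} {φ φ' : L.Formula (C ⊕ Fin n)}
    (h : Corresponds R φ φ') (hRS : R ⊆ S) : Corresponds S φ φ' :=
  fun c d hcd => h c d (hcd.mono (Set.union_subset_union_left _ hRS))

theorem Corresponds.not {R : Set (C × C)} {φ φ' : L.Formula (C ⊕ Fin n)}
    (h : Corresponds R φ φ') : Corresponds R φ.not φ'.not :=
  fun c d hcd => by rw [Formula.realize_not, Formula.realize_not, h c d hcd]

/-- The rank is invariant under finite partial elementary maps between sets over which partial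
elementary maps extend. -/
theorem FinRankGE.transfer {X Y : Set C} (hC : ExtendsMaps L ℵ₀ (Set.univ : Set C))
    (hX : ExtendsMaps L ℵ₀ X) (hY : ExtendsMaps L ℵ₀ Y) {R : Set (C × C)} (hfin : R.Finite)
    (hR : IsPartialElementary L R) (hRX : ∀ r ∈ R, r.1 ∈ X) (hRY : ∀ r ∈ R, r.2 ∈ Y)
    (hp : ∀ φ' ∈ p', ∃ φ ∈ p, Corresponds R φ φ') (h : FinRankGE D X α p) :
    FinRankGE D Y α p' := by
  induction α using Ordinal.limitRecOn generalizing R p p' with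
  | zero =>
    rw [finRankGE_zero] at h ⊢
    obtain ⟨c, hc⟩ := h
    obtain ⟨d, -, hd⟩ := hC.exists_tuple hR (fun _ _ => Set.mem_univ _) hfin c
    refine ⟨d, fun φ' hφ' => ?_⟩
    obtain ⟨φ, hφ, hφφ'⟩ := hp φ' hφ'
    exact (hφφ' c d hd).1 (hc φ hφ)
  | add_one α ih =>
    rw [finRankGE_add_one] at h ⊢
    obtain ⟨⟨φ, hφ, h₁, h₂⟩, h₃⟩ := h
    constructor
    · obtain ⟨d, hdY, hd⟩ := hY.exists_map hR hRY hfin (params_finite φ)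
      set R' := R ∪ (fun s => (s, d s)) '' params φ with hR'
      have hfin' : R'.Finite := hfin.union ((params_finite φ).image _)
      have hX' : ∀ r ∈ R', r.1 ∈ X := by
        rintro _ (hr | ⟨s, hs, rfl⟩)
        exacts [hRX _ hr, hφ hs]
      have hY' : ∀ r ∈ R', r.2 ∈ Y := by
        rintro _ (hr | ⟨s, hs, rfl⟩)
        exacts [hRY _ hr, hdY _ hs]
      let e : C ⊕ Fin n → C ⊕ Fin n := Sum.map d id
      have hcor : Corresponds R' φ (φ.relabel e) := by
        intro c c' hcc'
        rw [Formula.realize_relabel]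
        have : Sum.elim id c' ∘ e = Sum.elim d c' := by ext (a | a) <;> rfl
        rw [this]
        exact hcc'.realize_params φ (fun a ha => Or.inl (Or.inr ⟨a, ha, rfl⟩))
          fun i => Or.inr ⟨i, rfl⟩
      have hpar : params (φ.relabel e) ⊆ Y := by
        intro c hc
        obtain ⟨s, hs, rfl⟩ := params_relabel_map φ d hc
        exact hdY s hs
      have hp' : ∀ φ' ∈ p', ∃ φ ∈ p, Corresponds R' φ φ' := fun φ' hφ' => by
        obtain ⟨φ, hφ, h⟩ := hp φ' hφ'
        exact ⟨φ, hφ, h.mono Set.subset_union_left⟩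
      refine ⟨φ.relabel e, hpar, ih hfin' hd hX' hY' ?_ h₁, ih hfin' hd hX' hY' ?_ h₂⟩
      · rintro φ' (hφ' | rfl)
        · obtain ⟨φ, hφ, h⟩ := hp' φ' hφ'
          exact ⟨φ, Or.inl hφ, h⟩
        · exact ⟨φ, Or.inr rfl, hcor⟩
      · rintro φ' (hφ' | rfl)
        · obtain ⟨φ, hφ, h⟩ := hp' φ' hφ'
          exact ⟨φ, Or.inl hφ, h⟩
        · exact ⟨φ.not, Or.inr rfl, hcor.not⟩
    · intro m a ha
      -- Clause (a) moves a formula forwards into `Y`; clause (b) quantifies over tuples of `Y`,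
      -- which must be pulled back into `X` along the inverse map. The same `q` then serves on both
      -- sides.
      obtain ⟨a', ha'X, ha'⟩ := hX.exists_tuple hR.swap (by
        rintro _ ⟨r, hr, rfl⟩
        exact hRX r hr) (hfin.image _) a
      have hR' : IsPartialElementary L (R ∪ pairs a' a) := by
        have := ha'.swap
        rwa [Set.image_union, swap_pairs, Set.image_image, Set.image_congr (g := id) (by simp),
          Set.image_id] at this
      obtain ⟨q, hq, h₄⟩ := h₃ m a' ha'X
      refine ⟨q, hq, ih (hfin.union (pairs_finite _ _)) hR' ?_ ?_ ?_ h₄⟩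
      · rintro _ (hr | ⟨i, rfl⟩)
        exacts [hRX _ hr, ha'X i]
      · rintro _ (hr | ⟨i, rfl⟩)
        exacts [hRY _ hr, ha i]
      · rintro φ' (hφ' | ⟨ψ, hψ, rfl⟩)
        · obtain ⟨φ, hφ, h⟩ := hp φ' hφ'
          exact ⟨φ, Or.inl hφ, h.mono Set.subset_union_left⟩
        · refine ⟨_, Or.inr ⟨ψ, hψ, rfl⟩, fun c d hcd => ?_⟩
          rw [Formula.realize_relabel, Formula.realize_relabel]
          refine hcd.realize_iff (fun i => ?_) ψ
          induction i using Fin.addCases with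
          | left i => simpa using Or.inr ⟨i, rfl⟩
          | right i => simpa using Or.inl (Or.inr ⟨i, rfl⟩)
  | limit α hα ih =>
    rw [finRankGE_of_isSuccLimit hα] at h ⊢
    exact fun β hβ => ih β hβ hfin hR hRX hRY hp (h β hβ)

end Rank

/-! ### Conjugation, sequences and finite sets of rationals -/

section PairLemmas

variable {L : FirstOrder.Language.{u, v}} {C : Type w} [L.Structure C]

/-- `U` is contained in the composite of the inverse of `P`, then `Q`, then `P'`. When `P` and `P'`
send `c` to two copies of it, a map `Q` fixing `c` becomes a map between the copies. -/
theorem IsPartialElementary.conj {P P' Q U : Set (C × C)} (hP : IsPartialElementary L P)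
    (hQ : IsPartialElementary L Q) (hP' : IsPartialElementary L P')
    (hU : ∀ r ∈ U, ∃ y z, (y, r.1) ∈ P ∧ (y, z) ∈ Q ∧ (z, r.2) ∈ P') :
    IsPartialElementary L U := by
  choose y z hy hyz hz using hU
  refine (hP.swap.comp hQ (U := Set.range fun r : U => (r.1.1, z r.1 r.2)) ?_).comp hP' ?_
  · rintro _ ⟨r, rfl⟩
    exact ⟨y r.1 r.2, ⟨_, hy r.1 r.2, rfl⟩, hyz r.1 r.2⟩
  · exact fun r hr => ⟨z r hr, ⟨⟨r, hr⟩, rfl⟩, hz r hr⟩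

/-- The pairs of corresponding entries of two families of tuples, at the indices in `F`. -/
def seqPairs {ι J : Type*} (F : Set ι) (s t : ι → J → C) : Set (C × C) :=
  {r | ∃ q ∈ F, ∃ j, r = (s q j, t q j)}

theorem seqPairs_finite {ι J : Type*} [Finite J] {F : Set ι} (hF : F.Finite) (s t : ι → J → C) :
    (seqPairs F s t).Finite := by
  have : seqPairs F s t = ⋃ q ∈ F, pairs (s q) (t q) := by
    ext r
    simp [seqPairs, pairs, eq_comm]
  rw [this]
  exact hF.biUnion fun q _ => pairs_finite _ _

/-- Every element of a sequence can be chosen depending on its predecessors. -/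
theorem exists_seq_of_forall_exists {S : Type*} [Nonempty S] (P : ℕ → (ℕ → S) → S → Prop)
    (hcongr : ∀ k t t', (∀ l < k, t l = t' l) → ∀ x, P k t x → P k t' x)
    (hex : ∀ k t, (∀ l < k, P l t (t l)) → ∃ x, P k t x) : ∃ t, ∀ k, P k t (t k) := by
  classical
  -- Only the entries of `G k` below `k` are final; the others are arbitrary, which is harmless by
  -- `hcongr`.
  let G : ℕ → ℕ → S := fun k => Nat.rec (fun _ => Classical.arbitrary S)
    (fun k t => Function.update t k (Classical.epsilon (P k t))) k
  have hG : ∀ k, G (k + 1) = Function.update (G k) k (Classical.epsilon (P k (G k))) :=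
    fun k => rfl
  have hagree : ∀ k, ∀ l < k, G k l = G (l + 1) l := by
    intro k
    induction k with
    | zero => intro l hl; omega
    | succ k ih =>
      intro l hl
      rcases Nat.lt_succ_iff_lt_or_eq.1 hl with h | rfl
      · rw [hG, Function.update_of_ne h.ne, ih l h]
      · rfl
  refine ⟨fun k => G (k + 1) k, fun k => ?_⟩
  induction k using Nat.strong_induction_on with
  | _ k ih =>
    obtain ⟨x, hx⟩ := hex k _ ih
    have := Classical.epsilon_spec (p := P k (G k))
      ⟨x, hcongr k _ _ (fun l hl => (hagree k l hl).symm) x hx⟩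
    have h2 := hcongr k _ (fun k => G (k + 1) k) (fun l hl => hagree k l hl) _ this
    simpa [hG k] using h2

theorem exists_strictMonoOn_nat {ι : Type*} [LinearOrder ι] {F : Set ι} (hF : F.Finite) :
    ∃ e : ι → ℕ, StrictMonoOn e F := by
  classical
  refine ⟨fun q => (hF.toFinset.filter (· < q)).card, fun q hq r hr hqr => ?_⟩
  refine Finset.card_lt_card ⟨fun x hx => ?_, fun h => ?_⟩
  · simp only [Finset.mem_filter] at hx ⊢
    exact ⟨hx.1, hx.2.trans hqr⟩
  · have := h (show q ∈ _ by simpa using ⟨hq, hqr⟩)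
    simp at this

/-- The point `v` is never in `F`, and no element of `F` lies strictly between `q` and `v`. If `q ∉
F`, then `q` and `v` fill the same cut of `F`. -/
theorem exists_gt_of_finite {F : Set ℚ} (hF : F.Finite) (q : ℚ) :
    ∃ v, q < v ∧ ∀ x ∈ F, q < x → v < x := by
  have h : ∀ᶠ v in nhdsWithin q (Set.Ioi q), ∀ x ∈ F, q < x → v < x := by
    refine (Filter.eventually_all_finite hF).2 fun x _ => ?_
    by_cases hx : q < x
    · filter_upwards [Ioo_mem_nhdsGT hx] with v hv _ using hv.2
    · exact Filter.Eventually.of_forall fun v h => absurd h hx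
  obtain ⟨v, hv, hv'⟩ := (h.and self_mem_nhdsWithin).exists
  exact ⟨v, hv', hv⟩

end PairLemmas

/-! ### Finite non-splitting and absence of order -/

section Splitting

variable {L : FirstOrder.Language.{u, v}} {C : Type w} [L.Structure C] {n m : ℕ}

variable (L) in
/-- The type of `c` over `X` does not split over `B`. -/
def NonSplitting (X B : Set C) (c : Fin n → C) : Prop :=
  ∀ R : Set (C × C), R.Finite → diag B ⊆ R → (∀ r ∈ R, r.1 ∈ X ∧ r.2 ∈ X) →
    IsPartialElementary L R → IsPartialElementary L (R ∪ pairs c c)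

theorem NonSplitting.mono {X B B' : Set C} {c : Fin n → C} (h : NonSplitting L X B c)
    (hB : B ⊆ B') : NonSplitting L X B' c :=
  fun R hfin hd hX hR => h R hfin ((Set.image_mono hB).trans hd) hX hR

/-- The formulas over `B` satisfied by `c`. -/
def typeOver (L : FirstOrder.Language.{u, v}) [L.Structure C] (B : Set C) (c : Fin n → C) :
    Set (L.Formula (C ⊕ Fin n)) :=
  {φ | params φ ⊆ B ∧ φ.Realize (Sum.elim id c)}

theorem corresponds_self {R : Set (C × C)} {φ : L.Formula (C ⊕ Fin n)}
    (h : diag (params φ) ⊆ R) : Corresponds R φ φ :=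
  fun _ _ hcd => hcd.realize_params φ (fun a ha => Or.inl (h ⟨a, ha, rfl⟩))
    fun i => Or.inr ⟨i, rfl⟩

variable {T : L.Theory} {D : Diagram T} [Nonempty C] [C ⊨ T]

/-- Let `γ` be the least ordinal at which the rank of some finite restriction of the type of `c`
fails, and let `B` witness this. Then `γ = α + 1`, while all finite restrictions have rank at least
`α`. A splitting over `B` would give a formula dividing the restriction to `B` into two parts of
rank at least `α`, contradicting the choice of `B`. -/
theorem exists_nonSplitting (hD : IsTotallyTranscendental D C)
    (hCD : IsDSet D (Set.univ : Set C)) (hC : ExtendsMaps L ℵ₀ (Set.univ : Set C))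
    {X : Set C} (hX : ExtendsMaps L ℵ₀ X) (c : Fin n → C) :
    ∃ B ⊆ X, B.Finite ∧ NonSplitting L X B c := by
  let O : Set Ordinal.{max u v w} :=
    {γ | ∃ B ⊆ X, B.Finite ∧ ¬ FinRankGE D X γ (typeOver L B c)}
  have hdom : dom (typeOver L (∅ : Set C) c) ⊆ X := by
    rintro a ⟨φ, hφ, ha⟩
    exact absurd (hφ.1 ha) (Set.notMem_empty a)
  have hO : O.Nonempty := by
    obtain ⟨α, hα⟩ := hD.exists_not_finRankGE hdom
    exact ⟨α, ∅, Set.empty_subset _, Set.finite_empty, hα⟩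
  obtain ⟨γ, ⟨B, hBX, hB, hγ⟩, hmin⟩ := WellFounded.has_min wellFounded_lt O hO
  have hmin' : ∀ β < γ, ∀ B ⊆ X, B.Finite → FinRankGE D X β (typeOver L B c) := by
    intro β hβ B hBX hB
    by_contra h
    exact hmin β ⟨B, hBX, hB, h⟩ hβ
  refine ⟨B, hBX, hB, ?_⟩
  clear hmin hO
  induction γ using Ordinal.limitRecOn with
  | zero => exact absurd (finRankGE_zero.2 ⟨c, fun φ hφ => hφ.2⟩) hγ
  | limit γ hlim _ =>
    exact absurd ((finRankGE_of_isSuccLimit hlim).2 fun β hβ => hmin' β hβ B hBX hB) hγ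
  | add_one α _ =>
    have hα := hmin' α (by simp)
    intro R hfin hdiag hRX hR
    by_contra hsplit
    have hψ : ∃ ψ : L.Formula (R ⊕ Fin n), ψ.Realize (Sum.elim (fun r => r.1.1) c) ∧
        ¬ ψ.Realize (Sum.elim (fun r => r.1.2) c) := by
      by_contra hne
      push Not at hne
      refine hsplit (.of_imp (I := R ⊕ Fin n) _ _ hne ?_)
      rintro r (hr | ⟨i, rfl⟩)
      · exact ⟨Sum.inl ⟨r, hr⟩, rfl, rfl⟩
      · exact ⟨Sum.inr i, rfl, rfl⟩
    obtain ⟨ψ, h₁, h₂⟩ := hψ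
    have key : ∀ (f : C × C → C) (d : Fin n → C),
        (ψ.relabel (Sum.map (fun r : R => f r) id)).Realize (Sum.elim id d) ↔
          ψ.Realize (Sum.elim (fun r : R => f r) d) := by
      intro f d
      rw [Formula.realize_relabel]
      have : Sum.elim id d ∘ Sum.map (fun r : R => f r) id = Sum.elim (fun r : R => f r) d := by
        ext (a | a) <;> rfl
      rw [this]
    have hpar : ∀ f : C × C → C,
        params (ψ.relabel (Sum.map (fun r : R => f r) id)) ⊆ f '' R := by
      intro f a ha
      obtain ⟨i | i, -, hi⟩ := mem_params_relabel _ _ _ ha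
      · exact ⟨i, i.2, Sum.inl_injective hi⟩
      · simp at hi
    have hsub : ∀ (f : C × C → C) (φ : L.Formula (C ⊕ Fin n)), (∀ r ∈ R, f r ∈ X) →
        params φ ⊆ f '' R → φ.Realize (Sum.elim id c) →
        FinRankGE D X α (typeOver L B c ∪ {φ}) := by
      intro f φ hf hφ hr
      refine (hα (B ∪ f '' R) (Set.union_subset hBX ?_) (hB.union (hfin.image _))).anti ?_
      · rintro _ ⟨r, hr, rfl⟩
        exact hf r hr
      · rintro φ' (h | rfl)
        · exact ⟨h.1.trans Set.subset_union_left, h.2⟩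
        · exact ⟨hφ.trans Set.subset_union_right, hr⟩
    refine hγ (finRankGE_add_one.2 ⟨⟨ψ.relabel (Sum.map (fun r : R => r.1.1) id), ?_, ?_, ?_⟩, ?_⟩)
    · refine (hpar Prod.fst).trans ?_
      rintro _ ⟨r, hr, rfl⟩
      exact (hRX r hr).1
    · exact hsub Prod.fst _ (fun r hr => (hRX r hr).1) (hpar _) ((key Prod.fst c).2 h₁)
    · have h₃ := hsub Prod.snd (ψ.relabel (Sum.map (fun r : R => r.1.2) id)).not
        (fun r hr => (hRX r hr).2) (by rw [params_not]; exact hpar _)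
        (Formula.realize_not.2 fun h => h₂ ((key Prod.snd c).1 h))
      refine FinRankGE.transfer hC hX hX (hfin.image _) hR.swap ?_ ?_ ?_ h₃
      · rintro _ ⟨r, hr, rfl⟩
        exact (hRX r hr).2
      · rintro _ ⟨r, hr, rfl⟩
        exact (hRX r hr).1
      · rintro φ' (hφ' | rfl)
        · refine ⟨φ', Or.inl hφ', corresponds_self ?_⟩
          rintro _ ⟨a, ha, rfl⟩
          exact ⟨(a, a), hdiag ⟨a, hφ'.1 ha, rfl⟩, rfl⟩
        · refine ⟨_, Or.inr rfl, Corresponds.not fun d d' hdd' => ?_⟩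
          rw [key Prod.snd, key Prod.fst]
          refine hdd'.realize_iff ?_ ψ
          rintro (r | i)
          · exact Or.inl ⟨r, r.2, rfl⟩
          · exact Or.inr ⟨i, rfl⟩
    · intro k a ha
      refine ⟨T.typeOf (Fin.addCases c a), hCD _ _ fun _ => Set.mem_univ _, ?_⟩
      refine (hα (B ∪ Set.range a) (Set.union_subset hBX ?_) (hB.union (Set.finite_range a))).anti ?_
      · rintro _ ⟨j, rfl⟩
        exact ha j
      · rintro φ' (h | ⟨θ, hθ, rfl⟩)
        · exact ⟨h.1.trans Set.subset_union_left, h.2⟩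
        · refine ⟨fun b hb => ?_, ?_⟩
          · obtain ⟨i, -, hi⟩ := mem_params_relabel _ _ _ hb
            induction i using Fin.addCases with
            | left i => simp at hi
            | right i => exact Or.inr ⟨i, by simpa using hi⟩
          · rw [Theory.CompleteType.formula_mem_typeOf] at hθ
            rw [Formula.realize_relabel]
            convert hθ using 1
            ext i
            induction i using Fin.addCases <;> simp

/-- A totally transcendental diagram does not have the order property, witnessed by an indiscernible
sequence of order type `ℚ`. -/
theorem IsTotallyTranscendental.false_of_order (hD : IsTotallyTranscendental D C)
    (hCD : IsDSet D (Set.univ : Set C)) (t : ℚ → Fin n ⊕ Fin m → C)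
    (hind : ∀ F : Set ℚ, F.Finite → ∀ g : ℚ → ℚ, StrictMonoOn g F →
      IsPartialElementary L (seqPairs F t (t ∘ g)))
    (φ : L.Formula (Fin n ⊕ Fin m))
    (hφ : ∀ q r, φ.Realize (Sum.elim (t q ∘ Sum.inl) (t r ∘ Sum.inr)) ↔ q ≤ r) : False := by
  let E : Set ℚ → Set C := fun F => {c | ∃ q ∈ F, ∃ j, c = t q j}
  have hEmono : ∀ {F G : Set ℚ}, F ⊆ G → E F ⊆ E G := by
    rintro F G h _ ⟨q, hq, j, rfl⟩
    exact ⟨q, h hq, j, rfl⟩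
  have move : ∀ (F : Set ℚ) (q v : ℚ), F.Finite → q ∉ F → q < v → (∀ x ∈ F, q < x → v < x) →
      ∀ ψ : L.Formula (C ⊕ Fin n), params ψ ⊆ E F →
        ψ.Realize (Sum.elim id (t q ∘ Sum.inl)) → ψ.Realize (Sum.elim id (t v ∘ Sum.inl)) := by
    intro F q v hF hq hqv hv ψ hψ hr
    have hne : ∀ x ∈ F, Function.update id q v x = x := fun x hx =>
      Function.update_of_ne (fun h => hq (by rwa [← h])) _ _
    have hg : StrictMonoOn (Function.update id q v) (insert q F) := by
      rintro x (rfl | hx) y (rfl | hy) hxy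
      · exact absurd hxy (lt_irrefl _)
      · rw [hne y hy, Function.update_self]
        exact hv y hy hxy
      · rw [hne x hx, Function.update_self]
        exact hxy.trans hqv
      · rwa [hne x hx, hne y hy]
    refine ((hind _ (hF.insert q) _ hg).realize_params ψ (fun a ha => ?_) fun i => ?_).1 hr
    · obtain ⟨x, hx, j, rfl⟩ := hψ ha
      exact ⟨x, Or.inr hx, j, by simp [hne x hx]⟩
    · exact ⟨q, Or.inl rfl, Sum.inl i, by simp⟩
  -- The condition `q ∉ F` leaves room to move `q` within its cut of `F` without changing the type
  -- over `E F`.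
  have main : ∀ (α : Ordinal.{max u v w}) (F : Set ℚ) (q : ℚ), F.Finite → q ∉ F →
      ∀ p : Set (L.Formula (C ⊕ Fin n)), p ⊆ typeOver L (E F) (t q ∘ Sum.inl) →
        FinRankGE D (E Set.univ) α p := by
    intro α
    induction α using Ordinal.limitRecOn with
    | zero =>
      intro F q _ _ p hp
      exact finRankGE_zero.2 ⟨_, fun ψ hψ => (hp hψ).2⟩
    | limit α hα ih =>
      intro F q hF hq p hp
      exact (finRankGE_of_isSuccLimit hα).2 fun β hβ => ih β hβ F q hF hq p hp
    | add_one α ih =>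
      intro F q hF hq p hp
      rw [finRankGE_add_one]
      constructor
      -- With `q < r < v` in one cut of `F`, the first halves of `t q` and `t v` have the same type
      -- over `E F`, but the formula `φ(x, t r)` separates them.
      · obtain ⟨v, hqv, hv⟩ := exists_gt_of_finite hF q
        obtain ⟨r, hqr, hrv⟩ := exists_between hqv
        have hvF : v ∉ F := fun h => lt_irrefl _ (hv v h hqv)
        let θ : L.Formula (C ⊕ Fin n) :=
          φ.relabel (Sum.elim Sum.inr fun j => Sum.inl (t r (Sum.inr j)))
        have hθ : ∀ y, θ.Realize (Sum.elim id (t y ∘ Sum.inl)) ↔ y ≤ r := by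
          intro y
          rw [← hφ, Formula.realize_relabel]
          have : (Sum.elim id (t y ∘ Sum.inl) ∘
            Sum.elim Sum.inr fun j => Sum.inl (t r (Sum.inr j)))
              = Sum.elim (t y ∘ Sum.inl) (t r ∘ Sum.inr) := by
            ext (a | a) <;> rfl
          rw [this]
        have hθp : params θ ⊆ E {r} := by
          intro a ha
          obtain ⟨i | i, -, hi⟩ := mem_params_relabel _ _ _ ha
          · simp at hi
          · exact ⟨r, rfl, _, (Sum.inl_injective hi).symm⟩
        refine ⟨θ, hθp.trans (hEmono (Set.subset_univ _)),
          ih (insert r F) q (hF.insert r) ?_ _ ?_, ih (insert r F) v (hF.insert r) ?_ _ ?_⟩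
        · rintro (h | h)
          exacts [hqr.ne h, hq h]
        · rintro ψ (hψ | rfl)
          · exact ⟨(hp hψ).1.trans (hEmono (Set.subset_insert _ _)), (hp hψ).2⟩
          · exact ⟨hθp.trans (hEmono (by simp)), (hθ q).2 hqr.le⟩
        · rintro (h | h)
          exacts [hrv.ne' h, hvF h]
        · rintro ψ (hψ | rfl)
          · exact ⟨(hp hψ).1.trans (hEmono (Set.subset_insert _ _)),
              move F q v hF hq hqv hv ψ (hp hψ).1 (hp hψ).2⟩
          · refine ⟨?_, Formula.realize_not.2 fun h => ((hθ v).1 h).not_gt hrv⟩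
            rw [params_not]
            exact hθp.trans (hEmono (by simp))
      · intro k a ha
        choose ρ _ κ hκ using ha
        -- The index `q` may occur among the indices `ρ` of the new parameters, so it is replaced by
        -- a nearby `v` outside them.
        obtain ⟨v, hqv, hv⟩ := exists_gt_of_finite (hF.union (Set.finite_range ρ)) q
        refine ⟨T.typeOf (Fin.addCases (t v ∘ Sum.inl) a), hCD _ _ fun _ => Set.mem_univ _,
          ih (F ∪ Set.range ρ) v (hF.union (Set.finite_range ρ))
            (fun h => lt_irrefl _ (hv v h hqv)) _ ?_⟩
        rintro ψ (hψ | ⟨θ, hθ, rfl⟩)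
        · exact ⟨(hp hψ).1.trans (hEmono Set.subset_union_left),
            move F q v hF hq hqv (fun x hx => hv x (Or.inl hx)) ψ (hp hψ).1 (hp hψ).2⟩
        · refine ⟨fun b hb => ?_, ?_⟩
          · obtain ⟨i, -, hi⟩ := mem_params_relabel _ _ _ hb
            induction i using Fin.addCases with
            | left i => simp at hi
            | right i =>
              rw [Fin.addCases_right] at hi
              exact ⟨ρ i, Or.inr ⟨i, rfl⟩, κ i, by rw [← hκ]; exact (Sum.inl_injective hi).symm⟩
          · rw [Theory.CompleteType.formula_mem_typeOf] at hθ
            rw [Formula.realize_relabel]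
            convert hθ using 1
            ext i
            induction i using Fin.addCases <;> simp
  have hdom : dom (∅ : Set (L.Formula (C ⊕ Fin n))) ⊆ E Set.univ := by
    rintro a ⟨ψ, hψ, -⟩
    exact absurd hψ (Set.notMem_empty _)
  obtain ⟨α, hα⟩ := hD.exists_not_finRankGE hdom
  exact hα (main α ∅ 0 Set.finite_empty (Set.notMem_empty _) ∅ (Set.empty_subset _))

end Splitting

/-! ### Indiscernible sequences and symmetry of non-splitting -/

section Symmetry

variable {L : FirstOrder.Language.{u, v}} {C : Type w} [L.Structure C] {n m : ℕ}

/-- If every two increasing reindexings by `ℕ` of a sequence are conjugate, then the sequence can be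
stretched to a sequence indexed by `ℚ`. -/
theorem exists_stretch {J : Type*} [Finite J] (hC : ExtendsMaps L ℵ₀ (Set.univ : Set C))
    (s : ℕ → J → C)
    (hs : ∀ F : Set ℚ, F.Finite → ∀ e e' : ℚ → ℕ, StrictMonoOn e F → StrictMonoOn e' F →
      IsPartialElementary L (seqPairs F (s ∘ e) (s ∘ e'))) :
    ∃ t : ℚ → J → C, ∀ F : Set ℚ, F.Finite → ∀ e : ℚ → ℕ, StrictMonoOn e F →
      IsPartialElementary L (seqPairs F (s ∘ e) t) := by
  obtain ⟨r⟩ : Nonempty (ℕ ≃ ℚ) := ⟨(Denumerable.eqv ℚ).symm⟩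
  let I : ℕ → Set ℚ := fun k => {q | r.symm q < k}
  have hI : ∀ k, (I k).Finite := fun k =>
    (Set.finite_lt_nat k).preimage r.symm.injective.injOn
  have : Nonempty (J → C) := ⟨s 0⟩
  obtain ⟨t, ht⟩ := exists_seq_of_forall_exists
    (fun k t x => ∀ e : ℚ → ℕ, StrictMonoOn e (I (k + 1)) →
      IsPartialElementary L
        (seqPairs (I k) (s ∘ e) (t ∘ r.symm) ∪ pairs (s (e (r k))) x)) (by
      intro k t t' htt' x h e he
      refine (h e he).mono ?_
      rintro _ (⟨q, hq, j, rfl⟩ | hr)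
      · exact Or.inl ⟨q, hq, j, by simp [htt' _ hq]⟩
      · exact Or.inr hr) (by
      intro k t hprev
      obtain ⟨e, he⟩ := exists_strictMonoOn_nat (hI (k + 1))
      have hle : I k ⊆ I (k + 1) := fun q hq => Nat.lt_succ_of_lt hq
      have hk : r k ∈ I (k + 1) := by simp [I]
      have h₀ : IsPartialElementary L (seqPairs (I k) (s ∘ e) (t ∘ r.symm)) := by
        rcases k with _ | k
        · refine (isPartialElementary_diag ∅).mono ?_
          rintro _ ⟨q, hq, -⟩
          exact absurd hq (Nat.not_lt_zero _)
        · refine (hprev k (Nat.lt_succ_self k) e (he.mono hle)).mono ?_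
          rintro _ ⟨q, hq, j, rfl⟩
          rcases Nat.lt_succ_iff_lt_or_eq.1 hq with h | h
          · exact Or.inl ⟨q, h, j, rfl⟩
          · refine Or.inr ⟨j, ?_⟩
            simp [← h]
      obtain ⟨x, -, hx⟩ := hC.exists_tuple h₀ (fun _ _ => Set.mem_univ _)
        (seqPairs_finite (hI k) _ _) (s (e (r k)))
      -- The tuple `x` was found for one increasing `e`; conjugacy of the reindexings gives every
      -- other `e'`.
      refine ⟨x, fun e' he' => (hs _ (hI (k + 1)) e' e he' he).comp hx ?_⟩
      rintro _ (⟨q, hq, j, rfl⟩ | ⟨j, rfl⟩)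
      · exact ⟨_, ⟨q, hle hq, j, rfl⟩, Or.inl ⟨q, hq, j, rfl⟩⟩
      · exact ⟨_, ⟨r k, hk, j, rfl⟩, Or.inr ⟨j, rfl⟩⟩)
  refine ⟨t ∘ r.symm, fun F hF e he => ?_⟩
  obtain ⟨k, hk⟩ := (hF.image r.symm).bddAbove
  have hFk : F ⊆ I (k + 1) := fun q hq => Nat.lt_succ_of_le (hk ⟨q, hq, rfl⟩)
  obtain ⟨e', he'⟩ := exists_strictMonoOn_nat (hI (k + 1))
  refine (hs F hF e e' he (he'.mono hFk)).comp (ht k e' he') ?_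
  rintro _ ⟨q, hq, j, rfl⟩
  refine ⟨_, ⟨q, hq, j, rfl⟩, ?_⟩
  rcases Nat.lt_succ_iff_lt_or_eq.1 (hFk hq) with h | h
  · exact Or.inl ⟨q, h, j, rfl⟩
  · refine Or.inr ⟨j, ?_⟩
    simp [← h]

variable (L) in
/-- `s` is a sequence in `X` of pairs of tuples, in which every tuple realizes, over `B` and its
predecessors, the type of `c` (first components) or of `b` (second components). -/
structure IsMorley (X B : Set C) (c : Fin n → C) (b : Fin m → C) (s : ℕ → Fin n ⊕ Fin m → C) :
    Prop where
  mem : ∀ k j, s k j ∈ X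
  left : ∀ k, IsPartialElementary L
    (diag (B ∪ {x | ∃ l < k, ∃ j, x = s l j}) ∪ pairs c (s k ∘ Sum.inl))
  right : ∀ k, IsPartialElementary L
    (diag (B ∪ {x | ∃ l < k, ∃ j, x = s l j} ∪ Set.range (s k ∘ Sum.inl)) ∪
      pairs b (s k ∘ Sum.inr))

theorem diag_finite {B : Set C} (hB : B.Finite) : (diag B).Finite := hB.image _

theorem exists_isMorley {X B : Set C} (hX : ExtendsMaps L ℵ₀ X) (hBX : B ⊆ X) (hB : B.Finite)
    (c : Fin n → C) (b : Fin m → C) [Nonempty C] : ∃ s, IsMorley L X B c b s := by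
  obtain ⟨s, hs⟩ := exists_seq_of_forall_exists (S := Fin n ⊕ Fin m → C)
    (fun k s x => (∀ j, x j ∈ X) ∧ IsPartialElementary L
        (diag (B ∪ {x | ∃ l < k, ∃ j, x = s l j}) ∪ pairs c (x ∘ Sum.inl)) ∧
      IsPartialElementary L (diag (B ∪ {x | ∃ l < k, ∃ j, x = s l j} ∪
        Set.range (x ∘ Sum.inl)) ∪ pairs b (x ∘ Sum.inr))) (by
      intro k t t' htt' x h
      have : {x | ∃ l < k, ∃ j, x = t l j} = {x | ∃ l < k, ∃ j, x = t' l j} := by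
        ext x
        refine exists_congr fun l => and_congr_right fun hl => ?_
        rw [htt' l hl]
      rwa [← this]) (by
      intro k s hprev
      set E : Set C := B ∪ {x | ∃ l < k, ∃ j, x = s l j} with hE
      have hEX : E ⊆ X := by
        rintro _ (h | ⟨l, hl, j, rfl⟩)
        exacts [hBX h, (hprev l hl).1 j]
      have hEfin : E.Finite := by
        refine hB.union ?_
        have : {x | ∃ l < k, ∃ j, x = s l j} = ⋃ l ∈ Set.Iio k, Set.range (s l) := by
          ext x
          simp [eq_comm]
        rw [this]
        exact (Set.finite_Iio k).biUnion fun l _ => Set.finite_range _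
      obtain ⟨a, haX, ha⟩ := hX.exists_tuple (isPartialElementary_diag E) (by
        rintro _ ⟨x, hx, rfl⟩
        exact hEX hx) (diag_finite hEfin) c
      obtain ⟨d, hdX, hd⟩ := hX.exists_tuple (isPartialElementary_diag (E ∪ Set.range a)) (by
        rintro _ ⟨x, hx | ⟨i, rfl⟩, rfl⟩
        exacts [hEX hx, haX i]) (diag_finite (hEfin.union (Set.finite_range a))) b
      exact ⟨Sum.elim a d, by rintro (i | i) <;> simp [haX, hdX], by simpa using ha,
        by simpa using hd⟩)
  exact ⟨s, fun k => (hs k).1, fun k => (hs k).2.1, fun k => (hs k).2.2⟩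

/-- By induction on the largest index: non-splitting of `c` extends the map found so far by fixing
`c`, and conjugation replaces `c` by the two new first halves. The same argument with `b` then adds
the second halves. -/
theorem IsMorley.indiscernible {X Y B : Set C} (hXY : X ⊆ Y) (hBX : B ⊆ X) (hB : B.Finite)
    {c : Fin n → C} {b : Fin m → C} (hc : NonSplitting L Y B c) (hb : NonSplitting L X B b)
    {s : ℕ → Fin n ⊕ Fin m → C} (hs : IsMorley L X B c b s) {ι : Type*} [LinearOrder ι]
    (F : Finset ι) (e e' : ι → ℕ) (he : StrictMonoOn e F) (he' : StrictMonoOn e' F) :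
    IsPartialElementary L (diag B ∪ seqPairs F (s ∘ e) (s ∘ e')) := by
  induction F using Finset.induction_on_max with
  | empty =>
    refine (isPartialElementary_diag B).mono ?_
    rintro _ (h | ⟨q, hq, -⟩)
    · exact h
    · simp at hq
  | insert q F hq ih =>
    have hF : (F : Set ι) ⊆ ↑(insert q F) := by simp
    have hqm : q ∈ (↑(insert q F) : Set ι) := by simp
    set R := diag B ∪ seqPairs F (s ∘ e) (s ∘ e') with hR
    have hR₀ : IsPartialElementary L R := ih (he.mono hF) (he'.mono hF)
    have hRfin : R.Finite := (diag_finite hB).union (seqPairs_finite F.finite_toSet _ _)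
    have hRX : ∀ r ∈ R, r.1 ∈ X ∧ r.2 ∈ X := by
      rintro _ (⟨x, hx, rfl⟩ | ⟨x, hx, j, rfl⟩)
      · exact ⟨hBX hx, hBX hx⟩
      · exact ⟨hs.mem _ _, hs.mem _ _⟩
    have hlt : ∀ x ∈ F, e x < e q ∧ e' x < e' q := fun x hx =>
      ⟨he (hF hx) hqm (hq x hx), he' (hF hx) hqm (hq x hx)⟩
    have hold : ∀ r ∈ R, (r.1 ∈ B ∪ {x | ∃ l < e q, ∃ j, x = s l j}) ∧
        r.2 ∈ B ∪ {x | ∃ l < e' q, ∃ j, x = s l j} := by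
      rintro _ (⟨x, hx, rfl⟩ | ⟨x, hx, j, rfl⟩)
      · exact ⟨Or.inl hx, Or.inl hx⟩
      · exact ⟨Or.inr ⟨_, (hlt x hx).1, j, rfl⟩, Or.inr ⟨_, (hlt x hx).2, j, rfl⟩⟩
    have h₁ : IsPartialElementary L (R ∪ pairs (s (e q) ∘ Sum.inl) (s (e' q) ∘ Sum.inl)) := by
      refine (hs.left (e q)).conj (hc R hRfin Set.subset_union_left
        (fun r hr => ⟨hXY (hRX r hr).1, hXY (hRX r hr).2⟩) hR₀) (hs.left (e' q)) ?_
      rintro r (hr | ⟨i, rfl⟩)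
      · exact ⟨r.1, r.2, Or.inl ⟨_, (hold r hr).1, rfl⟩, Or.inl hr,
          Or.inl ⟨_, (hold r hr).2, rfl⟩⟩
      · exact ⟨c i, c i, Or.inr ⟨i, rfl⟩, Or.inr ⟨i, rfl⟩, Or.inr ⟨i, rfl⟩⟩
    refine (hs.right (e q)).conj (hb _ (hRfin.union (pairs_finite _ _))
      (Set.subset_union_left.trans Set.subset_union_left) ?_ h₁) (hs.right (e' q)) ?_
    · rintro _ (hr | ⟨i, rfl⟩)
      exacts [hRX _ hr, ⟨hs.mem _ _, hs.mem _ _⟩]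
    · have hR' : ∀ r ∈ R, ∃ y z, (y, r.1) ∈ diag (B ∪ {x | ∃ l < e q, ∃ j, x = s l j} ∪
          Set.range (s (e q) ∘ Sum.inl)) ∪ pairs b (s (e q) ∘ Sum.inr) ∧
          (y, z) ∈ R ∪ pairs (s (e q) ∘ Sum.inl) (s (e' q) ∘ Sum.inl) ∪ pairs b b ∧
          (z, r.2) ∈ diag (B ∪ {x | ∃ l < e' q, ∃ j, x = s l j} ∪
          Set.range (s (e' q) ∘ Sum.inl)) ∪ pairs b (s (e' q) ∘ Sum.inr) := fun r hr =>
        ⟨r.1, r.2, Or.inl ⟨_, Or.inl (hold r hr).1, rfl⟩, Or.inl (Or.inl hr),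
          Or.inl ⟨_, Or.inl (hold r hr).2, rfl⟩⟩
      rintro r (hr | ⟨x, hx, j, rfl⟩)
      · exact hR' r (Or.inl hr)
      · rcases Finset.mem_insert.1 hx with rfl | hx
        · rcases j with i | i
          · exact ⟨_, _, Or.inl ⟨_, Or.inr ⟨i, rfl⟩, rfl⟩, Or.inl (Or.inr ⟨i, rfl⟩),
              Or.inl ⟨_, Or.inr ⟨i, rfl⟩, rfl⟩⟩
          · exact ⟨b i, b i, Or.inr ⟨i, rfl⟩, Or.inr ⟨i, rfl⟩, Or.inr ⟨i, rfl⟩⟩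
        · exact hR' _ (Or.inr ⟨x, hx, j, rfl⟩)

variable {T : L.Theory} {D : Diagram T} [Nonempty C] [C ⊨ T]

/-- Symmetry: a realization in `X` of a sufficiently large part of the type of `c` also realizes the
type of `c` over `b`. -/
theorem NonSplitting.symmetry (hD : IsTotallyTranscendental D C)
    (hCD : IsDSet D (Set.univ : Set C)) (hC : ExtendsMaps L ℵ₀ (Set.univ : Set C))
    {X Y B : Set C} (hX : ExtendsMaps L ℵ₀ X) (hXY : X ⊆ Y) (hBX : B ⊆ X) (hB : B.Finite)
    {c : Fin n → C} {b : Fin m → C} (hc : NonSplitting L Y B c) (hb : NonSplitting L X B b)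
    (hbY : ∀ i, b i ∈ Y) {a : Fin n → C} (haX : ∀ i, a i ∈ X)
    (hac : IsPartialElementary L (diag B ∪ pairs a c)) :
    IsPartialElementary L (pairs a c ∪ pairs b b) := by
  refine .of_imp (Sum.elim a b) (Sum.elim c b) (fun φ hφa => ?_) (by
    rintro _ (⟨i, rfl⟩ | ⟨i, rfl⟩)
    exacts [⟨Sum.inl i, rfl, rfl⟩, ⟨Sum.inr i, rfl, rfl⟩])
  by_contra hφc
  obtain ⟨s, hs⟩ := exists_isMorley hX hBX hB c b
  have horder : ∀ k l, φ.Realize (Sum.elim (s k ∘ Sum.inl) (s l ∘ Sum.inr)) ↔ k ≤ l := by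
    intro k l
    rcases le_or_gt k l with hkl | hkl
    · simp only [hkl, iff_true]
      -- For `k ≤ l` the second half of `s l` may be replaced by `b`. Then non-splitting of `b`
      -- replaces the first half of `s k` by `a`, and `φ(a, b)` is true.
      have h₁ : φ.Realize (Sum.elim (s k ∘ Sum.inl) b) ↔
          φ.Realize (Sum.elim (s k ∘ Sum.inl) (s l ∘ Sum.inr)) := by
        refine (hs.right l).realize_iff ?_ φ
        rintro (i | i)
        · refine Or.inl ⟨_, ?_, rfl⟩
          rcases hkl.lt_or_eq with h | rfl
          · exact Or.inl (Or.inr ⟨k, h, _, rfl⟩)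
          · exact Or.inr ⟨i, rfl⟩
        · exact Or.inr ⟨i, rfl⟩
      have h₂ : IsPartialElementary L (diag B ∪ pairs (s k ∘ Sum.inl) a) := by
        refine (hs.left k).conj (isPartialElementary_diag (B ∪ Set.range c)) hac.swap ?_
        rintro _ (⟨x, hx, rfl⟩ | ⟨i, rfl⟩)
        · exact ⟨x, x, Or.inl ⟨x, Or.inl hx, rfl⟩, ⟨x, Or.inl hx, rfl⟩,
            ⟨(x, x), Or.inl ⟨x, hx, rfl⟩, rfl⟩⟩
        · exact ⟨c i, c i, Or.inr ⟨i, rfl⟩, ⟨_, Or.inr ⟨i, rfl⟩, rfl⟩,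
            ⟨(a i, c i), Or.inr ⟨i, rfl⟩, rfl⟩⟩
      have h₃ := hb _ ((diag_finite hB).union (pairs_finite _ _)) Set.subset_union_left (by
        rintro _ (⟨x, hx, rfl⟩ | ⟨i, rfl⟩)
        exacts [⟨hBX hx, hBX hx⟩, ⟨hs.mem _ _, haX i⟩]) h₂
      refine h₁.1 ((h₃.realize_iff ?_ φ).2 hφa)
      rintro (i | i)
      exacts [Or.inl (Or.inr ⟨i, rfl⟩), Or.inr ⟨i, rfl⟩]
    · simp only [hkl.not_ge, iff_false]
      -- For `l < k` the first half of `s k` may be replaced by `c`. Then non-splitting of `c`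
      -- replaces the second half of `s l` by `b`, and `φ(c, b)` is false.
      have h₁ : φ.Realize (Sum.elim c (s l ∘ Sum.inr)) ↔
          φ.Realize (Sum.elim (s k ∘ Sum.inl) (s l ∘ Sum.inr)) := by
        refine (hs.left k).realize_iff ?_ φ
        rintro (i | i)
        · exact Or.inr ⟨i, rfl⟩
        · exact Or.inl ⟨_, Or.inr ⟨l, hkl, _, rfl⟩, rfl⟩
      have h₂ : IsPartialElementary L (diag B ∪ pairs b (s l ∘ Sum.inr)) := by
        refine (hs.right l).mono (Set.union_subset_union_left _ (Set.image_mono ?_))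
        exact Set.subset_union_left.trans Set.subset_union_left
      have h₃ := hc _ ((diag_finite hB).union (pairs_finite _ _)) Set.subset_union_left (by
        rintro _ (⟨x, hx, rfl⟩ | ⟨i, rfl⟩)
        exacts [⟨hXY (hBX hx), hXY (hBX hx)⟩, ⟨hbY i, hXY (hs.mem _ _)⟩]) h₂
      refine fun h => hφc ((h₃.realize_iff ?_ φ).2 (h₁.2 h))
      rintro (i | i)
      exacts [Or.inr ⟨i, rfl⟩, Or.inl (Or.inr ⟨i, rfl⟩)]
  obtain ⟨t, ht⟩ := exists_stretch hC s (by
    intro F hF e e' he he'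
    have := hs.indiscernible hXY hBX hB hc hb hF.toFinset e e' (by simpa) (by simpa)
    exact this.mono (by simp))
  refine hD.false_of_order hCD t (fun F hF g hg => ?_) φ fun q r => ?_
  · obtain ⟨e, he⟩ := exists_strictMonoOn_nat (hF.image g)
    have heg : StrictMonoOn (e ∘ g) F := he.comp hg fun x hx => ⟨x, hx, rfl⟩
    refine (ht F hF _ heg).swap.comp (ht _ (hF.image g) e he) ?_
    rintro _ ⟨x, hx, j, rfl⟩
    exact ⟨s (e (g x)) j, ⟨_, ⟨x, hx, j, rfl⟩, rfl⟩, ⟨g x, ⟨x, hx, rfl⟩, j, rfl⟩⟩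
  · have hfin : ({q, r} : Set ℚ).Finite := Set.toFinite _
    obtain ⟨e, he⟩ := exists_strictMonoOn_nat hfin
    rw [← he.le_iff_le (Set.mem_insert _ _) (Set.mem_insert_of_mem _ rfl), ← horder]
    refine ((ht _ hfin e he).realize_iff ?_ φ).symm
    rintro (i | i)
    · exact ⟨q, Or.inl rfl, _, rfl⟩
    · exact ⟨r, Or.inr rfl, _, rfl⟩

end Symmetry

/-! ### Unions of chains -/

section Chains

variable {L : FirstOrder.Language.{u, v}} {C : Type w} [L.Structure C] {ι : Type*}
  [LinearOrder ι] [Nonempty ι] {M : ι → L.ElementarySubstructure C}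

theorem exists_subset_of_finite (hmono : Monotone M) {S : Set C} (hS : S.Finite)
    (hSM : S ⊆ ⋃ i, (M i : Set C)) : ∃ i, S ⊆ (M i : Set C) := by
  choose! f hf using fun x (hx : x ∈ S) => Set.mem_iUnion.1 (hSM hx)
  obtain ⟨i, hi⟩ := (hS.image f).bddAbove
  exact ⟨i, fun x hx => hmono (hi ⟨x, hx, rfl⟩) (hf x hx)⟩

/-- Finitely many values already lie in one member of the chain. Infinitely many need not, and there
symmetry takes over. -/
theorem extendsMaps_iUnion (hmono : Monotone M) (hM : ∀ i, ExtendsMaps L ℵ₀ (M i : Set C)) :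
    ExtendsMaps L ℵ₀ (⋃ i, (M i : Set C)) := by
  intro R hR hX hfin c
  obtain ⟨i, hi⟩ := exists_subset_of_finite hmono (Cardinal.lt_aleph0_iff_set_finite.1 hfin) (by
    rintro _ ⟨r, hr, rfl⟩
    exact hX r hr)
  obtain ⟨d, hd, hdR⟩ := hM i R hR (fun r hr => hi ⟨r, hr, rfl⟩) hfin c
  exact ⟨d, Set.mem_iUnion.2 ⟨i, hd⟩, hdR⟩

/-- The union of a chain of elementary substructures over which partial elementary maps extend. -/
theorem exists_elementarySubstructure_iUnion (hmono : Monotone M)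
    (hM : ∀ i, ExtendsMaps L ℵ₀ (M i : Set C)) :
    ∃ N : L.ElementarySubstructure C, (N : Set C) = ⋃ i, (M i : Set C) := by
  let S : L.Substructure C :=
    { carrier := ⋃ i, (M i : Set C)
      fun_mem := fun {k} f x hx => by
        obtain ⟨i, hi⟩ := exists_subset_of_finite hmono (Set.finite_range x) (by
          rintro _ ⟨j, rfl⟩
          exact hx j)
        exact Set.mem_iUnion.2 ⟨i, (M i).toSubstructure.fun_mem f x fun j => hi ⟨j, rfl⟩⟩ }
  -- Tarski–Vaught test: extending the identity on the parameters to a witness in `C` yields a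
  -- witness in the union.
  refine ⟨⟨S, S.isElementary_of_exists fun k φ x a hφ => ?_⟩, rfl⟩
  obtain ⟨d, hd, hR⟩ := extendsMaps_iUnion hmono hM (diag (Set.range fun j => (x j : C)))
    (isPartialElementary_diag _) (by
      rintro _ ⟨_, ⟨j, rfl⟩, rfl⟩
      exact (x j).2) (mk_image_snd_lt_aleph0 (diag_finite (Set.finite_range _))) a
  refine ⟨⟨d, hd⟩, ?_⟩
  let ψ : L.Formula (Fin (k + 1)) := φ.toFormula.relabel (Sum.elim Empty.elim id)
  have hψ : ∀ y : Fin (k + 1) → C, ψ.Realize y ↔ φ.Realize default y := by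
    intro y
    rw [Formula.realize_relabel, BoundedFormula.realize_toFormula]
    have : (y ∘ Sum.elim Empty.elim id) ∘ Sum.inl = (default : Empty → C) :=
      Subsingleton.elim _ _
    rw [this]
    rfl
  rw [← hψ] at hφ ⊢
  refine (hR.realize_iff (fun j => ?_) ψ).1 hφ
  induction j using Fin.lastCases with
  | last => simp
  | cast j => simpa using Or.inr ⟨_, ⟨j, rfl⟩, rfl⟩

/-- A union of finite sets indexed by the finite subsets of a set of cardinality less than `μ`. -/
theorem mk_iUnion_finset_lt {A : Set C} {μ : Cardinal.{w}} (hμ : ℵ₀ ≤ μ) (hA : #A < μ)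
    {B : Finset A → Set C} (hB : ∀ s, (B s).Finite) : #(⋃ s, B s : Set C) < μ := by
  rcases finite_or_infinite A with h | h
  · exact ((Set.finite_iUnion hB).lt_aleph0).trans_le hμ
  · refine (mk_iUnion_le B).trans_lt (lt_of_le_of_lt ?_ hA)
    rw [mk_finset_of_infinite]
    refine (mul_le_mul_right (ciSup_le' fun s => (hB s).lt_aleph0.le) _).trans ?_
    rw [mul_aleph0_eq (aleph0_le_mk A)]

variable {T : L.Theory} {D : Diagram T} [Nonempty C] [C ⊨ T]

theorem isHomogeneous_of_coe_eq_iUnion (hD : IsTotallyTranscendental D C) {χ μ : Cardinal.{w}}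
    (hC : IsHomogeneous D χ (⊤ : L.ElementarySubstructure C)) (hμ : ℵ₀ ≤ μ) (hμχ : μ < χ)
    (hmono : Monotone M) (hM : ∀ i, IsHomogeneous D μ (M i)) {N : L.ElementarySubstructure C}
    (hN : (N : Set C) = ⋃ i, (M i : Set C)) : IsHomogeneous D μ N := by
  classical
  have hCD : IsDSet D (Set.univ : Set C) := hC.isDSet
  have hCext : ExtendsMaps L ℵ₀ (Set.univ : Set C) :=
    (IsHomogeneous.extendsMaps hCD hC).mono (hμ.trans hμχ.le)
  have hMext : ∀ i, ExtendsMaps L ℵ₀ (M i : Set C) := fun i =>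
    (IsHomogeneous.extendsMaps hCD (hM i)).mono hμ
  have hNext : ExtendsMaps L ℵ₀ (N : Set C) := hN ▸ extendsMaps_iUnion hmono hMext
  refine ⟨fun k a _ => hCD k a fun _ => Set.mem_univ _, fun A hA hAμ p hp => ?_⟩
  obtain ⟨c, -, hc⟩ := hC.realizes A (fun _ _ => trivial) (hAμ.trans hμχ) p hp
  obtain ⟨B₀, hB₀N, hB₀, hsplit⟩ := exists_nonSplitting hD hCD hCext hNext c
  obtain ⟨i, hi⟩ := exists_subset_of_finite hmono hB₀ (hN ▸ hB₀N)
  have hiN : (M i : Set C) ⊆ N := hN ▸ Set.subset_iUnion (fun i => (M i : Set C)) i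
  -- All finite subsets of `A` are enumerated as tuples, and their non-splitting bases are taken
  -- over the one model `M i` that contains `B₀`.
  let b : ∀ s : Finset A, Fin s.card → C := fun s j => (s.equivFin.symm j : A)
  choose B hBM hB hBsplit using fun s => exists_nonSplitting hD hCD hCext (hMext i) (b s)
  set E : Set C := B₀ ∪ ⋃ s, B s with hE
  have hEμ : #E < μ := (mk_union_le _ _).trans_lt
    (add_lt_of_lt hμ (hB₀.lt_aleph0.trans_le hμ) (mk_iUnion_finset_lt hμ hAμ hB))
  have hEM : E ⊆ M i := Set.union_subset hi (Set.iUnion_subset hBM)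
  obtain ⟨a, haM, ha⟩ := IsHomogeneous.extendsMaps hCD (hM i) (diag E)
    (isPartialElementary_diag E) (by
      rintro _ ⟨x, hx, rfl⟩
      exact hEM hx) (by rwa [diag, Set.image_image, Set.image_id']) (c 0)
  refine ⟨fun _ => a, fun _ => hiN haM, fun φ hφ => ?_⟩
  have hφA : params φ ⊆ A := fun x hx => hp.isCompleteType.dom_subset ⟨φ, hφ, hx⟩
  let s : Finset A := (params_finite φ).toFinset.subtype (· ∈ A)
  -- Symmetry with `X = M i` and `Y = N`: the element `a` is in the smaller model, and the
  -- parameters of `φ` only in the larger.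
  have hsym := NonSplitting.symmetry hD hCD hCext (hMext i) hiN
    (Set.union_subset hi (hBM s)) (hB₀.union (hB s))
    (hsplit.mono Set.subset_union_left) ((hBsplit s).mono Set.subset_union_right)
    (fun j => hA (s.equivFin.symm j : A).2) (a := fun _ => a) (fun _ => haM) (ha.swap.mono (by
      rintro _ (⟨x, hx, rfl⟩ | ⟨j, rfl⟩)
      · exact ⟨(x, x), Or.inr ⟨x, hx.imp id fun h => Set.mem_iUnion.2 ⟨s, h⟩, rfl⟩, rfl⟩
      · exact ⟨(c 0, a), Or.inl rfl, by rw [Subsingleton.elim j 0]; rfl⟩))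
  refine (hsym.realize_params φ (v := id) (v' := id) (fun x hx => Or.inr ?_)
    fun j => Or.inl ⟨j, rfl⟩).2 (hc φ hφ)
  have hxs : (⟨x, hφA hx⟩ : A) ∈ s := by simpa [s] using hx
  exact ⟨s.equivFin ⟨_, hxs⟩, by simp [b]⟩

end Chains

end FiniteDiagram

theorem theorem4p9 {L : FirstOrder.Language.{u, v}} (T : L.Theory)
    (D : FiniteDiagram.Diagram T)
    -- the large homogeneous model in which everything takes place
    (C : Type w) [L.Structure C] [Nonempty C] [FirstOrder.Language.Theory.Model C T]
    (χ : Cardinal.{w}) (hC : FiniteDiagram.IsHomogeneous D χ (⊤ : L.ElementarySubstructure C))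
    (hD : FiniteDiagram.IsTotallyTranscendental D C)
    (μ : Cardinal.{w}) (hμ : Cardinal.aleph0 ≤ μ) (hμχ : μ < χ)
    (α : Ordinal.{x}) (hα : 0 < α) (M : Set.Iio α → L.ElementarySubstructure C)
    (hmono : Monotone M) (hM : ∀ i, FiniteDiagram.IsHomogeneous D μ (M i)) :
    ∃ N : L.ElementarySubstructure C,
      (N : Set C) = ⋃ i, (M i : Set C) ∧ FiniteDiagram.IsHomogeneous D μ N := by
  have : Nonempty (Set.Iio α) := ⟨⟨0, hα⟩⟩
  have hCD : FiniteDiagram.IsDSet D (Set.univ : Set C) := hC.isDSet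
  obtain ⟨N, hN⟩ := FiniteDiagram.exists_elementarySubstructure_iUnion hmono fun i =>
    (FiniteDiagram.IsHomogeneous.extendsMaps hCD (hM i)).mono hμ
  exact ⟨N, hN, FiniteDiagram.isHomogeneous_of_coe_eq_iUnion hD hC hμ hμχ hmono hM hN⟩
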